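/- Stoch-Reward $k$-TSP. An instance consists of a finite set $V$ with a metric $d$ (distinct vertices may be at distance $0$), a vertex $\mathsf{root}\in V$, a target $k\in\mathbb Z_{\ge 0}$, and for every $v\in V$ a probability distribution on $\mathbb Z_{\ge 0}$; the rewards $(R_v)_{v\in V}$ are independent with these distributions, and the value of $R_v$ becomes known only when $v$ is visited. An adaptive policy is a decision tree (every root-to-leaf path is finite) whose nodes are the vertices visited and whose branches are the reward values observed there; it determines a random closed tour $\Pi$ that starts and ends at $\mathsf{root}$ and visits the vertices on the realized branch in order, and its expected tour length is $\mathbb E[d(\Pi)]$. A policy is feasible if almost surely it collects $\sum_{v\in\Pi}R_v\ge k$ or has visited all of $V$; in particular it collects reward at least $k$ almost surely whenever $\sum_{v\in V}R_v\ge k$ almost surely. A non-adaptive policy is given by an ordered list of vertices, fixed in advance: starting at $\mathsf{root}$ it visits the vertices in this order, and stops (and returns to $\mathsf{root}$) as soon as the collected reward is at least $k$, or when the list is exhausted. Theorem. There is a universal constant $C<\infty$ such that for every instance there is a feasible non-adaptive policy whose expected tour length is at most $C\cdot\mathsf{OPT}$, where $\mathsf{OPT}$ is the infimum of the expected tour lengths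 of all feasible adaptive policies. -/

import Mathlib

open MeasureTheory
open scoped ENNReal NNReal

namespace StochKTSP

/-- An instance of Stoch-Reward k-TSP on the finite vertex set `V` with metric `dist`: a root, a
target `k`, and for every vertex the distribution of its (non-negative integer) reward.
Distances between distinct vertices may be zero (co-located vertices). -/
structure Inst (V : Type*) where
  root : V
  k : ℕ
  reward : V → PMF ℕ

/-- An adaptive policy: a decision tree whose nodes are the vertices visited and whose branches
are the reward values observed there. Leaves are the points where the policy stops. -/
inductive Policy (V : Type*) where
  | halt : Policy V
  | visit (v : V) (next : ℕ → Policy V) : Policy V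

/-- The vertices visited by the policy, in order, when the rewards are `ω`. (Visiting a vertex
again shows the same reward again.) -/
def Policy.path {V : Type*} : Policy V → (V → ℕ) → List V
  | .halt, _ => []
  | .visit v next, ω => v :: (next (ω v)).path ω

/-- Length of the walk that starts at `x`, goes through the given vertices in order, and ends
at `r`. -/
def walkLength {V : Type*} [PseudoMetricSpace V] (r : V) : V → List V → ℝ
  | x, [] => dist x r
  | x, v :: l => dist x v + walkLength r v l

/-- Follow a fixed list of vertices until the reward collected reaches `k` or the list is
exhausted; `seen` are the vertices visited so far and `got` is the reward collected so far. -/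
def followTour {V : Type*} [DecidableEq V] (k : ℕ) : Finset V → ℕ → List V → Policy V
  | _, _, [] => .halt
  | seen, got, v :: l =>
    if k ≤ got then .halt
    else .visit v fun x =>
      followTour k (insert v seen) (if v ∈ seen then got else got + x) l

namespace Inst

variable {V : Type*} (I : Inst V)

/-- The joint distribution of the rewards: they are independent. -/
noncomputable def law [Fintype V] : Measure (V → ℕ) :=
  Measure.pi fun v => (I.reward v).toMeasure

/-- The set of vertices on the tour that starts at the root and visits the vertices of `p`. -/
def visited [DecidableEq V] (p : List V) : Finset V :=
  insert I.root p.toFinset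

/-- The policy is complete if, almost surely, its tour collects reward at least `k`, unless all
vertices have been visited. So whenever the vertices of `V` have total reward at least `k`, the tour
collects reward at least `k`; and when they do not, it visits all of them. -/
def Complete [Fintype V] [DecidableEq V] (T : Policy V) : Prop :=
  ∀ᵐ ω ∂I.law, I.k ≤ ∑ v ∈ I.visited (T.path ω), ω v ∨ I.visited (T.path ω) = Finset.univ

/-- Expected length of the tour of the policy, which starts and ends at the root. -/
noncomputable def expectedLength [Fintype V] [PseudoMetricSpace V] (T : Policy V) : ℝ≥0∞ :=
  ∫⁻ ω, ENNReal.ofReal (walkLength I.root I.root (T.path ω)) ∂I.law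

/-- The optimal expected tour length over all complete adaptive policies. -/
noncomputable def opt [Fintype V] [DecidableEq V] [PseudoMetricSpace V] : ℝ≥0∞ :=
  ⨅ (T : Policy V) (_ : I.Complete T), I.expectedLength T

/-- The non-adaptive policy given by an ordered list of vertices: starting with the root, visit
the vertices in this order and stop as soon as the reward collected reaches `k`. -/
def nonAdaptive [DecidableEq V] (l : List V) : Policy V :=
  .visit I.root fun x => followTour I.k {I.root} x l

end Inst

end StochKTSP

/-!
The non-adaptive tour is built in phases with budgets `B = β, (5/4) β, (5/4)² β, …`. It suffices that
a phase, at cost `80 * B`, multiplies the probability of falling short of the target by at most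
`3/4`, up to `100 * P(tour of the adaptive policy T is longer than B)` (`Inst.exists_phase`). Indeed,
`5/4 * 3/4 < 1`, so the expected costs of the phases sum to `O(β + E[length of T])`
(`Inst.exists_phases`, `Inst.sum_tail_le`), and `β` can be taken to be the optimum, unless this is
zero; then the vertices at distance zero from the root suffice.

For one phase, let `S` be the vertices visited before, and condition on the event `F` that they fall
short; it may be assumed that the tour of `T` exceeds `B` with small conditional probability. Call a
set reachable if it arises from `S` by adding boundedly many walks of length `B`, let `A` be the
random set that `T` visits, and let `u` be the largest number such that, for every reachable set `a`,
the policy collects at least `u` in `A \ a` with conditional probability at least `1/2`.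

* By maximality there is a reachable set `a` such that `T` collects at most `u` in `A \ a` with
  probability at least `1/2`.
* For every reachable set `a`, a Wald-type inequality (`Inst.lintegral_expWeight_mul_le`) turns
  "collects `u` outside `a` with probability `1/2`" into a statement about the set `A` alone: an
  independent sample of the rewards of `A \ a` has expected weight `E[exp (- reward / u)]` bounded
  away from `1` on average. So, if `b` is the union of the sets visited by many independent runs of
  `T`, then the reward of `b` outside the set `A` of one further run is at least `u` with probability
  near `1`: those rewards are not seen by that run (`Inst.lintegral_weight_unvisited`), and every run
  contributes new vertices. A suitable fixed `b` is found greedily (`Inst.exists_reach_step`).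

With constant probability, therefore, the vertices of `A` that are missing from `a ∪ b` have total
reward at most `u`, and `a ∪ b` has reward at least `u` outside `A`. Hence the reward of `a ∪ b` is at
least that of `A`, which reaches the target (if some short tour of `T` visits all vertices, that tour
itself is the phase).
-/

namespace StochKTSP

open Finset ProbabilityTheory

/-! ### Independence of the rewards -/

section Independence

variable {V : Type*}

instance Inst.isProbabilityMeasure_law [Fintype V] (I : Inst V) : IsProbabilityMeasure I.law := by
  unfold Inst.law; infer_instance

theorem dependsOn_ite_mul [DecidableEq V] {a : Finset V} {F : (V → ℕ) → ℝ≥0∞}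
    (hF : DependsOn F (a : Set V)) (v : V) (x : ℕ) :
    DependsOn (fun ω => (if ω v = x then 1 else 0) * F ω) ((insert v a : Finset V) : Set V) := by
  intro y z hyz
  have h1 : F y = F z := hF fun i hi => hyz i (by simp at hi ⊢; exact Or.inr hi)
  simp only [h1, hyz v (by simp)]

variable [Fintype V] (I : Inst V)

/-- The reward of `v` is independent of every function of the other rewards. -/
theorem Inst.lintegral_mul_eval {a : Set V} {F : (V → ℕ) → ℝ≥0∞} (hF : DependsOn F a) {v : V}
    (hv : v ∉ a) (φ : ℕ → ℝ≥0∞) :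
    ∫⁻ ω, F ω * φ (ω v) ∂I.law = (∫⁻ ω, F ω ∂I.law) * ∫⁻ ω, φ (ω v) ∂I.law := by
  classical
  have hind : iIndepFun (fun (i : V) (ω : V → ℕ) => ω i) I.law :=
    iIndepFun_pi (X := fun _ x => x) (fun i => measurable_id.aemeasurable)
  have h2 := hind.indepFun_finset ({v}ᶜ : Finset V) {v} (by simp [disjoint_compl_left])
    (fun i => measurable_pi_apply i)
  let E : (({v}ᶜ : Finset V) → ℕ) → (V → ℕ) :=
    fun x i => if h : i ∈ ({v}ᶜ : Finset V) then x ⟨i, h⟩ else 0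
  have h3 := h2.comp (φ := fun x => F (E x)) (ψ := fun x => φ (x ⟨v, by simp⟩))
    (measurable_of_countable _) (measurable_of_countable _)
  have hFE : ∀ ω : V → ℕ, F (E fun i => ω i) = F ω := by
    intro ω
    apply hF
    intro i hi
    have : i ≠ v := fun h => hv (h ▸ hi)
    simp [E, this]
  have h4 := lintegral_mul_eq_lintegral_mul_lintegral_of_indepFun
    (measurable_of_countable _) (measurable_of_countable _) h3
  simpa [Function.comp_def, hFE] using h4

theorem Inst.lintegral_mul_prod_eval [DecidableEq V] {a : Finset V} {F : (V → ℕ) → ℝ≥0∞}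
    (hF : DependsOn F (a : Set V)) {c : Finset V} (hc : Disjoint a c) (φ : ℕ → ℝ≥0∞) :
    ∫⁻ ω, F ω * ∏ v ∈ c, φ (ω v) ∂I.law =
      ∫⁻ ω, F ω * ∏ v ∈ c, (∫⁻ ω', φ (ω' v) ∂I.law) ∂I.law := by
  induction c using Finset.induction_on generalizing a F with
  | empty => simp
  | insert v c hvc ih =>
    have hva : v ∉ a := fun h => (Finset.disjoint_left.1 hc h) (mem_insert_self _ _)
    have hF' : DependsOn (fun ω => F ω * φ (ω v)) ((insert v a : Finset V) : Set V) := by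
      intro x y hxy
      have h1 : F x = F y := hF fun i hi => hxy i (by simp at hi ⊢; exact Or.inr hi)
      simp only [h1, hxy v (by simp)]
    have hd : Disjoint (insert v a) c := by
      rw [Finset.disjoint_insert_left]
      exact ⟨hvc, hc.mono_right (Finset.subset_insert _ _)⟩
    have := ih hF' hd
    simp only [prod_insert hvc, ← mul_assoc]
    rw [this, lintegral_mul_const _ (measurable_of_countable _), I.lintegral_mul_eval hF hva,
      ← lintegral_mul_const _ (measurable_of_countable _),
      lintegral_mul_const _ (measurable_of_countable _),
      lintegral_mul_const _ (measurable_of_countable _),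
      lintegral_mul_const _ (measurable_of_countable _)]

theorem Inst.lintegral_eq_tsum_eval (v : V) (Ψ : ℕ → (V → ℕ) → ℝ≥0∞) :
    ∫⁻ ω, Ψ (ω v) ω ∂I.law = ∑' x, ∫⁻ ω, (if ω v = x then 1 else 0) * Ψ x ω ∂I.law := by
  rw [← lintegral_tsum fun x => (measurable_of_countable _).aemeasurable]
  congr 1 with ω
  rw [tsum_eq_single (ω v)]
  · simp
  · intro x hx
    simp [hx.symm]

end Independence

/-! ### Adaptive policies and multiplicative functionals of the rewards -/

section Wald

variable {V : Type*} [Fintype V] [DecidableEq V] (I : Inst V)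

/-- For a multiplicative weight `φ`, the expected weight of the rewards of the vertices in the
fixed set `c`. -/
noncomputable def Inst.expWeight (φ : ℕ → ℝ≥0∞) (c : Finset V) : ℝ≥0∞ :=
  ∏ v ∈ c, ∫⁻ ω, φ (ω v) ∂I.law

omit [DecidableEq V] in
theorem Inst.lintegral_eval_le_one {φ : ℕ → ℝ≥0∞} (hφ : ∀ x, φ x ≤ 1) (v : V) :
    ∫⁻ ω, φ (ω v) ∂I.law ≤ 1 := by
  calc _ ≤ ∫⁻ _, 1 ∂I.law := lintegral_mono fun ω : V → ℕ => hφ (ω v)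
    _ = 1 := by simp

omit [DecidableEq V] in
theorem Inst.expWeight_le_one {φ : ℕ → ℝ≥0∞} (hφ : ∀ x, φ x ≤ 1) (c : Finset V) :
    I.expWeight φ c ≤ 1 :=
  Finset.prod_le_one' fun v _ => I.lintegral_eval_le_one hφ v

/-- What a policy does not visit remains unobserved: for the unvisited part of a fixed set `b`, the
weight of the rewards may be replaced by its expectation. -/
theorem Inst.lintegral_weight_unvisited (φ : ℕ → ℝ≥0∞) (b : Finset V) (T : Policy V) {a : Finset V}
    {F : (V → ℕ) → ℝ≥0∞} (hF : DependsOn F (a : Set V)) :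
    ∫⁻ ω, F ω * ∏ v ∈ b \ (a ∪ (T.path ω).toFinset), φ (ω v) ∂I.law =
      ∫⁻ ω, F ω * I.expWeight φ (b \ (a ∪ (T.path ω).toFinset)) ∂I.law := by
  induction T generalizing a F with
  | halt =>
    simp only [Policy.path, List.toFinset_nil, union_empty]
    exact I.lintegral_mul_prod_eval hF Finset.disjoint_sdiff φ
  | visit v next ih =>
    have key : ∀ p : List V, a ∪ (v :: p).toFinset = insert v a ∪ p.toFinset := by
      intro p; ext x; simp
    simp only [Policy.path, key]
    rw [I.lintegral_eq_tsum_eval v fun x ω => F ω *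
        ∏ v' ∈ b \ (insert v a ∪ ((next x).path ω).toFinset), φ (ω v'),
      I.lintegral_eq_tsum_eval v fun x ω => F ω *
        I.expWeight φ (b \ (insert v a ∪ ((next x).path ω).toFinset))]
    congr 1 with x
    have := ih x (dependsOn_ite_mul hF v x)
    simpa only [mul_assoc] using this

/-- Wald-type inequality. Let `W` be the weight of the rewards that the policy collects outside `a`,
and `H` the weight that an independent sample is expected to have on the same vertices. Then
`E[H (1 - W)] ≤ E[1 - H]`: a policy cannot often see a small weight on vertices whose expected
weight is close to `1`. -/
theorem Inst.lintegral_expWeight_mul_le {φ : ℕ → ℝ≥0∞} (hφ : ∀ x, φ x ≤ 1) (T : Policy V)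
    {a : Finset V} {F : (V → ℕ) → ℝ≥0∞} (hF : DependsOn F (a : Set V)) :
    ∫⁻ ω, F ω * (I.expWeight φ ((T.path ω).toFinset \ a) *
        (1 + (1 - ∏ v ∈ (T.path ω).toFinset \ a, φ (ω v)))) ∂I.law ≤ ∫⁻ ω, F ω ∂I.law := by
  induction T generalizing a F with
  | halt => simp [Policy.path, Inst.expWeight]
  | visit v next ih =>
    have hsum : ∀ G : (V → ℕ) → ℝ≥0∞, DependsOn G (a : Set V) →
        ∫⁻ ω, G ω * (I.expWeight φ (((next (ω v)).path ω).toFinset \ insert v a) *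
          (1 + (1 - ∏ v' ∈ ((next (ω v)).path ω).toFinset \ insert v a, φ (ω v')))) ∂I.law ≤
        ∫⁻ ω, G ω ∂I.law := by
      intro G hG
      rw [I.lintegral_eq_tsum_eval v fun x ω => G ω *
        (I.expWeight φ (((next x).path ω).toFinset \ insert v a) *
          (1 + (1 - ∏ v' ∈ ((next x).path ω).toFinset \ insert v a, φ (ω v')))),
        I.lintegral_eq_tsum_eval v fun _ ω => G ω]
      refine ENNReal.tsum_le_tsum fun x => ?_
      simpa only [mul_assoc] using ih x (dependsOn_ite_mul hG v x)
    by_cases hva : v ∈ a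
    · have key : ∀ p : List V, (v :: p).toFinset \ a = p.toFinset \ insert v a := by
        intro p; ext x; simp only [List.toFinset_cons, mem_sdiff, mem_insert]
        constructor
        · rintro ⟨rfl | h, h'⟩
          · exact absurd hva h'
          · exact ⟨h, by rintro (rfl | h''); exacts [h' hva, h' h'']⟩
        · rintro ⟨h, h'⟩; exact ⟨Or.inr h, fun h'' => h' (Or.inr h'')⟩
      simp only [Policy.path, key]
      exact hsum F hF
    · have key : ∀ p : List V, (v :: p).toFinset \ a = insert v (p.toFinset \ insert v a) := by
        intro p; ext x; simp only [List.toFinset_cons, mem_sdiff, mem_insert]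
        by_cases hx : x = v
        · subst hx; simp [hva]
        · simp [hx]
      have hnot : ∀ p : List V, v ∉ p.toFinset \ insert v a := by intro p; simp
      set h := ∫⁻ ω, φ (ω v) ∂I.law with hh
      have h1 : h ≤ 1 := I.lintegral_eval_le_one hφ v
      -- `1 - φ W ≤ (1 - W) + (1 - φ)`, and the expectation of the last term is exactly `1 - h`
      have hpt : ∀ ω : V → ℕ, I.expWeight φ ((v :: (next (ω v)).path ω).toFinset \ a) *
          (1 + (1 - ∏ v' ∈ (v :: (next (ω v)).path ω).toFinset \ a, φ (ω v'))) ≤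
          h * (I.expWeight φ (((next (ω v)).path ω).toFinset \ insert v a) *
          (1 + (1 - ∏ v' ∈ ((next (ω v)).path ω).toFinset \ insert v a, φ (ω v')))) +
          (1 - φ (ω v)) := by
        intro ω
        rw [key, Inst.expWeight, prod_insert (hnot _), prod_insert (hnot _), ← hh]
        change h * I.expWeight φ _ * _ ≤ _
        have hH := I.expWeight_le_one hφ (((next (ω v)).path ω).toFinset \ insert v a)
        set H := I.expWeight φ (((next (ω v)).path ω).toFinset \ insert v a)
        have hW : ∏ v' ∈ ((next (ω v)).path ω).toFinset \ insert v a, φ (ω v') ≤ 1 :=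
          Finset.prod_le_one' fun v _ => hφ _
        set W := ∏ v' ∈ ((next (ω v)).path ω).toFinset \ insert v a, φ (ω v')
        have e : 1 - φ (ω v) * W ≤ (1 - W) + (1 - φ (ω v)) := by
          rw [tsub_le_iff_right]
          have hw := tsub_add_cancel_of_le (hφ (ω v))
          have hw' := tsub_add_cancel_of_le hW
          set y := 1 - φ (ω v)
          set x := 1 - W
          calc (1 : ℝ≥0∞) = x + 1 * W := by rw [one_mul, hw']
            _ = x + (y + φ (ω v)) * W := by rw [hw]
            _ = x + (y * W + φ (ω v) * W) := by rw [add_mul]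
            _ ≤ x + (y * 1 + φ (ω v) * W) := by gcongr
            _ = _ := by rw [mul_one, add_assoc]
        calc h * H * (1 + (1 - φ (ω v) * W)) ≤ h * H * (1 + ((1 - W) + (1 - φ (ω v)))) := by
              gcongr
          _ = h * (H * (1 + (1 - W))) + h * H * (1 - φ (ω v)) := by ring
          _ ≤ h * (H * (1 + (1 - W))) + 1 * 1 * (1 - φ (ω v)) := by gcongr
          _ = _ := by ring
      simp only [Policy.path]
      have hcomp : ∫⁻ ω, 1 - φ (ω v) ∂I.law + h = 1 := by
        rw [hh, ← lintegral_add_left (measurable_of_countable _)]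
        simp [tsub_add_cancel_of_le (hφ _)]
      calc _ ≤ ∫⁻ ω, h * (F ω * (I.expWeight φ (((next (ω v)).path ω).toFinset \ insert v a) *
          (1 + (1 - ∏ v' ∈ ((next (ω v)).path ω).toFinset \ insert v a, φ (ω v'))))) +
            F ω * (1 - φ (ω v)) ∂I.law := by
            refine lintegral_mono fun ω => ?_
            refine (mul_le_mul_right (hpt ω) (F ω)).trans (le_of_eq ?_)
            ring
        _ ≤ h * (∫⁻ ω, F ω ∂I.law) + (∫⁻ ω, F ω ∂I.law) * ∫⁻ ω, 1 - φ (ω v) ∂I.law := by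
            rw [lintegral_add_left (measurable_of_countable _),
              lintegral_const_mul _ (measurable_of_countable _),
              I.lintegral_mul_eval hF (by simpa using hva) fun x => 1 - φ x]
            exact add_le_add (mul_le_mul_right (hsum F hF) h) le_rfl
        _ = (∫⁻ ω, F ω ∂I.law) * (∫⁻ ω, 1 - φ (ω v) ∂I.law + h) := by ring
        _ = _ := by rw [hcomp, mul_one]

end Wald

/-! ### Walks -/

section Walk

variable {V : Type*} [PseudoMetricSpace V]

theorem dist_le_walkLength (r x : V) (l : List V) : dist x r ≤ walkLength r x l := by
  induction l generalizing x with
  | nil => simp [walkLength]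
  | cons v l ih => exact (dist_triangle x v r).trans (by simpa [walkLength] using ih v)

theorem walkLength_nonneg (r x : V) (l : List V) : 0 ≤ walkLength r x l :=
  dist_nonneg.trans (dist_le_walkLength r x l)

theorem walkLength_append_root (r x : V) (l l' : List V) :
    walkLength r x (l ++ r :: l') = walkLength r x l + walkLength r r l' := by
  induction l generalizing x with
  | nil => simp [walkLength]
  | cons v l ih => simp [walkLength, ih, add_assoc]

theorem walkLength_eq_zero {r : V} {l : List V} (h : ∀ v ∈ l, dist v r = 0) {x : V}
    (hx : dist x r = 0) : walkLength r x l = 0 := by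
  induction l generalizing x with
  | nil => simpa [walkLength] using hx
  | cons v l ih =>
    have hv := h v (by simp)
    have : dist x v = 0 := le_antisymm
      ((dist_triangle_right x v r).trans (by rw [hx, hv, add_zero])) dist_nonneg
    rw [walkLength, this, ih (fun w hw => h w (List.mem_cons_of_mem _ hw)) hv, add_zero]

theorem dist_le_walkLength_of_mem {r x v : V} {l : List V} (h : v ∈ l) :
    dist v r ≤ walkLength r x l := by
  induction l generalizing x with
  | nil => simp at h
  | cons w l ih =>
    rw [walkLength]
    rcases List.mem_cons.1 h with rfl | h
    · linarith [dist_le_walkLength r v l, dist_nonneg (x := x) (y := v)]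
    · linarith [ih (x := w) h, dist_nonneg (x := x) (y := w)]

end Walk

/-! ### One phase -/

section Phase

variable {V : Type*} [Fintype V] [DecidableEq V] (I : Inst V)

/-- The event that the vertices of `S` have total reward less than the target. -/
def Inst.short (S : Finset V) : Set (V → ℕ) := {ω | ∑ v ∈ S, ω v < I.k}

omit [Fintype V] [DecidableEq V] in
theorem Inst.short_anti {S S' : Finset V} (h : S ⊆ S') : I.short S' ⊆ I.short S := by
  intro ω hω
  change ∑ v ∈ S, ω v < I.k
  exact lt_of_le_of_lt (Finset.sum_le_sum_of_subset h) hω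

omit [Fintype V] [DecidableEq V] in
theorem Inst.dependsOn_short (S : Finset V) :
    DependsOn ((I.short S).indicator (1 : (V → ℕ) → ℝ≥0∞)) (S : Set V) := by
  intro x y hxy
  have : ∑ v ∈ S, x v = ∑ v ∈ S, y v := Finset.sum_congr rfl fun v hv => hxy v (by simpa using hv)
  have h : x ∈ I.short S ↔ y ∈ I.short S := by simp only [Inst.short, Set.mem_ofPred_eq, this]
  by_cases hy : y ∈ I.short S <;> simp [hy, h]

omit [DecidableEq V] in
theorem Inst.lintegral_indicator_mul (F : Set (V → ℕ)) (g : (V → ℕ) → ℝ≥0∞) :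
    ∫⁻ ω, F.indicator (1 : (V → ℕ) → ℝ≥0∞) ω * g ω ∂I.law = ∫⁻ ω in F, g ω ∂I.law := by
  rw [← lintegral_indicator (MeasurableSet.of_discrete)]
  congr 1 with ω
  by_cases h : ω ∈ F <;> simp [h]

omit [Fintype V] [DecidableEq V] in
theorem Inst.dependsOn_short_of_subset {S a : Finset V} (h : S ⊆ a) :
    DependsOn ((I.short S).indicator (1 : (V → ℕ) → ℝ≥0∞)) (a : Set V) :=
  fun _ _ hxy => I.dependsOn_short S fun i hi => hxy i (h hi)

omit [Fintype V] [DecidableEq V] in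
/-- The weight `exp (-x / u)`: it is multiplicative, and tells apart sums below and above `u`. -/
theorem exists_weight {u : ℕ} (hu : u ≠ 0) : ∃ φ : ℕ → ℝ≥0∞, (∀ x, φ x ≤ 1) ∧
    (∀ (c : Finset V) (ω : V → ℕ), u ≤ ∑ v ∈ c, ω v → ∏ v ∈ c, φ (ω v) ≤ 2⁻¹) ∧
    (∀ (c : Finset V) (ω : V → ℕ), ∑ v ∈ c, ω v < u → 3⁻¹ ≤ ∏ v ∈ c, φ (ω v)) := by
  have hu' : (0 : ℝ) < u := by positivity
  have hprod : ∀ (c : Finset V) (ω : V → ℕ), ∏ v ∈ c, ENNReal.ofReal (Real.exp (-(ω v / u : ℝ))) =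
      ENNReal.ofReal (Real.exp (-((∑ v ∈ c, ω v : ℕ) / u : ℝ))) := by
    intro c ω
    rw [← ENNReal.ofReal_prod_of_nonneg (fun _ _ => (Real.exp_pos _).le), ← Real.exp_sum]
    push_cast
    rw [Finset.sum_div, Finset.sum_neg_distrib]
  have he : Real.exp (-1) ≤ 2⁻¹ := by
    rw [Real.exp_neg]; exact inv_anti₀ (by norm_num) (by linarith [Real.exp_one_gt_d9])
  have he' : 3⁻¹ ≤ Real.exp (-1) := by
    rw [Real.exp_neg]; exact inv_anti₀ (Real.exp_pos 1) (by linarith [Real.exp_one_lt_d9])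
  refine ⟨fun x => ENNReal.ofReal (Real.exp (-(x / u : ℝ))), fun x => ?_, fun c ω h => ?_,
    fun c ω h => ?_⟩
  · rw [ENNReal.ofReal_le_one, Real.exp_le_one_iff]
    simp only [Left.neg_nonpos_iff]; positivity
  · rw [hprod]
    have : (1 : ℝ) ≤ (∑ v ∈ c, ω v : ℕ) / u := by
      rw [le_div_iff₀ hu', one_mul]; exact_mod_cast h
    calc _ ≤ ENNReal.ofReal 2⁻¹ :=
          ENNReal.ofReal_le_ofReal ((Real.exp_le_exp.2 (by linarith)).trans he)
      _ = _ := by rw [ENNReal.ofReal_inv_of_pos (by norm_num)]; simp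
  · rw [hprod]
    have : ((∑ v ∈ c, ω v : ℕ) / u : ℝ) ≤ 1 := by
      rw [div_le_one hu']; exact_mod_cast h.le
    calc (3⁻¹ : ℝ≥0∞) = ENNReal.ofReal 3⁻¹ := by
          rw [ENNReal.ofReal_inv_of_pos (by norm_num)]; simp
      _ ≤ _ := ENNReal.ofReal_le_ofReal (he'.trans (Real.exp_le_exp.2 (by linarith)))

/-- If, given that `S` falls short, the policy collects at least `u` outside `a` with probability at
least one half, then the vertices it visits outside `a` have small expected weight on average. -/
theorem Inst.setLIntegral_expWeight_le {φ : ℕ → ℝ≥0∞} (hφ : ∀ x, φ x ≤ 1) {u : ℕ}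
    (hφu : ∀ (c : Finset V) (ω : V → ℕ), u ≤ ∑ v ∈ c, ω v → ∏ v ∈ c, φ (ω v) ≤ 2⁻¹)
    (T : Policy V) {S a : Finset V} (hS : S ⊆ a)
    (hu : I.law (I.short S) / 2 ≤
      I.law (I.short S ∩ {ω | u ≤ ∑ v ∈ (T.path ω).toFinset \ a, ω v})) :
    ∫⁻ ω in I.short S, I.expWeight φ ((T.path ω).toFinset \ a) ∂I.law ≤
      5 / 6 * I.law (I.short S) := by
  have h1 := I.lintegral_expWeight_mul_le hφ T (I.dependsOn_short_of_subset hS)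
  rw [lintegral_indicator_mul, lintegral_indicator_one MeasurableSet.of_discrete] at h1
  set Z : Set (V → ℕ) := {ω | u ≤ ∑ v ∈ (T.path ω).toFinset \ a, ω v} with hZ
  set F := I.short S
  set H : (V → ℕ) → ℝ≥0∞ := fun ω => I.expWeight φ ((T.path ω).toFinset \ a) with hH
  have hH1 : ∀ ω, H ω ≤ 1 := fun ω => I.expWeight_le_one hφ _
  have h2 : ∫⁻ ω in F, H ω ∂I.law + ∫⁻ ω in F, Z.indicator 1 ω * H ω * 2⁻¹ ∂I.law ≤ I.law F := by
    rw [← lintegral_add_left (measurable_of_countable _)]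
    refine le_trans (lintegral_mono fun ω => ?_) h1
    rw [mul_add, mul_one]
    refine add_le_add le_rfl ?_
    by_cases hω : ω ∈ Z
    · have := hφu _ _ hω
      simp only [Set.indicator_of_mem hω, Pi.one_apply, one_mul]
      refine mul_le_mul_right ?_ _
      calc (2⁻¹ : ℝ≥0∞) = 1 - 2⁻¹ := by rw [ENNReal.one_sub_inv_two]
        _ ≤ _ := tsub_le_tsub_left this _
    · simp [hω]
  have h3 : I.law (F ∩ Z) + ∫⁻ ω in F, H ω ∂I.law ≤
      I.law F + ∫⁻ ω in F, Z.indicator 1 ω * H ω ∂I.law := by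
    have e1 : I.law (F ∩ Z) = ∫⁻ ω in F, Z.indicator 1 ω ∂I.law := by
      rw [lintegral_indicator_one MeasurableSet.of_discrete,
        Measure.restrict_apply MeasurableSet.of_discrete, Set.inter_comm]
    have e2 : I.law F = ∫⁻ _ in F, 1 ∂I.law := by simp
    rw [e1, e2, ← lintegral_add_left (measurable_of_countable _),
      ← lintegral_add_left (measurable_of_countable _)]
    refine lintegral_mono fun ω => ?_
    by_cases hω : ω ∈ Z <;> simp [hω, hH1 ω]
  rw [lintegral_mul_const _ (measurable_of_countable _)] at h2
  -- `x = E[1_F H]` and `z = E[1_F 1_Z H]` satisfy `x + z / 2 ≤ f` and `f / 2 + x ≤ f + z`, and so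
  -- `x ≤ 5 / 6 * f`
  have hF : I.law F ≠ ∞ := measure_ne_top _ _
  have hx : ∫⁻ ω in F, H ω ∂I.law ≠ ∞ := ne_top_of_le_ne_top hF (le_self_add.trans h2)
  have hz : ∫⁻ ω in F, Z.indicator 1 ω * H ω ∂I.law ≠ ∞ := by
    refine ne_top_of_le_ne_top hx (lintegral_mono fun ω => ?_)
    by_cases hω : ω ∈ Z <;> simp [hω]
  have h4 := (add_le_add_left hu _).trans h3
  generalize ∫⁻ ω in F, H ω ∂I.law = x at *
  generalize ∫⁻ ω in F, Z.indicator 1 ω * H ω ∂I.law = z at *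
  generalize I.law F = f at *
  lift f to ℝ≥0 using hF
  lift x to ℝ≥0 using hx
  lift z to ℝ≥0 using hz
  have h2' : x + z * 2⁻¹ ≤ f := by
    rw [← ENNReal.coe_le_coe]; push_cast; simpa using h2
  have h4' : f / 2 + x ≤ f + z := by
    rw [← ENNReal.coe_le_coe]; push_cast; simpa using h4
  have : x ≤ 5 / 6 * f := by
    rw [← NNReal.coe_le_coe] at *
    push_cast at *
    linarith
  have := ENNReal.coe_le_coe.2 this
  push_cast at this
  simpa using this

variable [PseudoMetricSpace V]

/-- The sets that are obtained from `S` by adding the vertices of a closed walk from the root of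
length at most `L`. -/
def Inst.Reach (S : Finset V) (L : ℝ) (a : Finset V) : Prop :=
  ∃ p : List V, walkLength I.root I.root p ≤ L ∧ a = S ∪ p.toFinset

variable {I}

omit [Fintype V] in
theorem Inst.Reach.subset {S a : Finset V} {L : ℝ} (h : I.Reach S L a) : S ⊆ a := by
  obtain ⟨p, -, rfl⟩ := h; exact Finset.subset_union_left

omit [Fintype V] in
theorem Inst.Reach.mono {S a : Finset V} {L L' : ℝ} (h : I.Reach S L a) (hL : L ≤ L') :
    I.Reach S L' a := by
  obtain ⟨p, hp, rfl⟩ := h; exact ⟨p, hp.trans hL, rfl⟩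

omit [Fintype V] in
theorem Inst.reach_self (S : Finset V) {L : ℝ} (hL : 0 ≤ L) : I.Reach S L S :=
  ⟨[], by simpa [walkLength] using hL, by simp⟩

omit [Fintype V] in
theorem Inst.Reach.union {S a : Finset V} {L L' : ℝ} (hr : I.root ∈ S) (h : I.Reach S L a)
    {p : List V} (hp : walkLength I.root I.root p ≤ L') : I.Reach S (L + L') (a ∪ p.toFinset) := by
  obtain ⟨q, hq, rfl⟩ := h
  refine ⟨q ++ I.root :: p, by rw [walkLength_append_root]; linarith, ?_⟩
  ext x
  simp only [mem_union, List.mem_toFinset, List.mem_append, List.mem_cons]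
  constructor
  · tauto
  · rintro (h | h | rfl | h) <;> tauto

omit [Fintype V] in
theorem Inst.Reach.union_reach {S a b : Finset V} {L L' : ℝ} (hr : I.root ∈ S)
    (ha : I.Reach S L a) (hb : I.Reach S L' b) : I.Reach S (L + L') (a ∪ b) := by
  have hs := ha.subset
  obtain ⟨p, hp, rfl⟩ := hb
  have := ha.union hr hp
  rwa [← Finset.union_assoc, Finset.union_eq_left.2 hs]

variable (I)

omit [PseudoMetricSpace V] in
theorem Inst.expWeight_union_sdiff (φ : ℕ → ℝ≥0∞) (b d c : Finset V) :
    I.expWeight φ ((b ∪ d) \ c) = I.expWeight φ (b \ c) * I.expWeight φ (d \ (c ∪ b)) := by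
  unfold Inst.expWeight
  rw [← Finset.prod_union]
  · congr 1
    ext x
    simp only [mem_sdiff, mem_union]
    tauto
  · rw [Finset.disjoint_left]
    intro x
    simp only [mem_sdiff, mem_union]
    tauto

/-- One step of a greedy choice, obtained by averaging over an independent run of the policy: some
closed walk of length at most `B` can be added to `b` so that the expected weight of the part of `b`
which the policy misses decreases by a constant factor on average. -/
theorem Inst.exists_reach_step {φ : ℕ → ℝ≥0∞} (hφ : ∀ x, φ x ≤ 1) (T : Policy V) {S b : Finset V}
    (hr : I.root ∈ S) {B L : ℝ} (hB : 0 ≤ B) (hb : I.Reach S L b)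
    (hF : I.law (I.short S) ≠ 0)
    (hsmall : I.law {ω | B < walkLength I.root I.root (T.path ω)} ≤ I.law (I.short S) / 100)
    (hw : ∀ a, I.Reach S (L + B) a →
      ∫⁻ ω in I.short S, I.expWeight φ ((T.path ω).toFinset \ a) ∂I.law ≤
        5 / 6 * I.law (I.short S)) :
    ∃ b', I.Reach S (L + B) b' ∧
      ∫⁻ ω in I.short S ∩ {ω | walkLength I.root I.root (T.path ω) ≤ B},
        I.expWeight φ (b' \ (S ∪ (T.path ω).toFinset)) ∂I.law ≤
      17 / 20 * ∫⁻ ω in I.short S ∩ {ω | walkLength I.root I.root (T.path ω) ≤ B},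
        I.expWeight φ (b \ (S ∪ (T.path ω).toFinset)) ∂I.law := by
  set G : Set (V → ℕ) := {ω | walkLength I.root I.root (T.path ω) ≤ B} with hG
  have hGc : {ω | B < walkLength I.root I.root (T.path ω)} = Gᶜ := by ext; simp [hG]
  rw [hGc] at hsmall
  set F := I.short S with hFdef
  classical
  -- an independent run adds the vertices it visits, or nothing if its tour is too long
  let D : (V → ℕ) → Finset V := fun ω => if ω ∈ G then (T.path ω).toFinset else ∅
  have hDreach : ∀ ω, I.Reach S (L + B) (b ∪ D ω) := by
    intro ω
    by_cases hω : ω ∈ G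
    · simpa [D, hω] using hb.union hr hω
    · simpa [D, hω] using hb.mono (by linarith)
  have hD : ∀ a, I.Reach S (L + B) a →
      ∫⁻ ω in F, I.expWeight φ (D ω \ a) ∂I.law ≤ 17 / 20 * I.law F := by
    intro a ha
    calc _ ≤ ∫⁻ ω in F, I.expWeight φ ((T.path ω).toFinset \ a) + Gᶜ.indicator 1 ω ∂I.law := by
          refine lintegral_mono fun ω => ?_
          by_cases hω : ω ∈ G
          · simp [D, hω]
          · simp [D, hω, Inst.expWeight]
      _ ≤ 5 / 6 * I.law F + I.law F / 100 := by
          rw [lintegral_add_left (measurable_of_countable _)]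
          refine add_le_add (hw a ha) ?_
          rw [lintegral_indicator_one MeasurableSet.of_discrete]
          exact (Measure.restrict_apply_le _ _).trans hsmall
      _ ≤ 17 / 20 * I.law F := by
          rw [ENNReal.div_eq_inv_mul (a := I.law F), ← add_mul]
          refine mul_le_mul_left ?_ _
          have : (5 / 6 + 100⁻¹ : ℝ≥0) ≤ 17 / 20 := by
            rw [← NNReal.coe_le_coe]; push_cast; norm_num
          have := ENNReal.coe_le_coe.2 this
          push_cast at this
          simpa using this
  have hswap : ∫⁻ ω' in F, ∫⁻ ω in F ∩ G,
      I.expWeight φ ((b ∪ D ω') \ (S ∪ (T.path ω).toFinset)) ∂I.law ∂I.law ≤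
      (17 / 20 * ∫⁻ ω in F ∩ G, I.expWeight φ (b \ (S ∪ (T.path ω).toFinset)) ∂I.law) *
        I.law F := by
    rw [lintegral_lintegral_swap (measurable_of_countable _).aemeasurable]
    calc _ ≤ ∫⁻ ω in F ∩ G, I.expWeight φ (b \ (S ∪ (T.path ω).toFinset)) *
          (17 / 20 * I.law F) ∂I.law := by
          refine setLIntegral_mono (measurable_of_countable _) fun ω hω => ?_
          simp only [I.expWeight_union_sdiff φ b]
          rw [lintegral_const_mul _ (measurable_of_countable _)]
          refine mul_le_mul_right (hD _ ?_) _
          have := hb.union hr (p := T.path ω) hω.2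
          have e : S ∪ (T.path ω).toFinset ∪ b = b ∪ (T.path ω).toFinset := by
            ext x
            simp only [mem_union]
            have := fun h : x ∈ S => hb.subset h
            tauto
          rwa [e]
      _ = _ := by
          rw [lintegral_mul_const _ (measurable_of_countable _)]
          ring
  by_contra! hcon
  have h1 : ∫⁻ ω' in F, (17 / 20 * ∫⁻ ω in F ∩ G,
      I.expWeight φ (b \ (S ∪ (T.path ω).toFinset)) ∂I.law) ∂I.law <
      ∫⁻ ω' in F, ∫⁻ ω in F ∩ G,
        I.expWeight φ ((b ∪ D ω') \ (S ∪ (T.path ω).toFinset)) ∂I.law ∂I.law := by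
    refine lintegral_strict_mono ?_ (measurable_of_countable _).aemeasurable ?_
      (Filter.Eventually.of_forall fun ω' => hcon _ (hDreach ω'))
    · rw [Ne, Measure.restrict_eq_zero]; exact hF
    · rw [setLIntegral_const]
      refine ENNReal.mul_ne_top (ENNReal.mul_ne_top ?_ ?_) (measure_ne_top _ _)
      · exact ENNReal.div_ne_top (by simp) (by simp)
      · refine ne_top_of_le_ne_top (measure_ne_top I.law (F ∩ G)) ?_
        calc _ ≤ ∫⁻ _ in F ∩ G, 1 ∂I.law := lintegral_mono fun ω => I.expWeight_le_one hφ _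
          _ = _ := by simp
  rw [setLIntegral_const] at h1
  exact absurd hswap (not_le.2 h1)

/-- The greedy choice, repeated `m` times from `S`. -/
theorem Inst.exists_reach_iterate {φ : ℕ → ℝ≥0∞} (hφ : ∀ x, φ x ≤ 1) (T : Policy V) {S : Finset V}
    (hr : I.root ∈ S) {B : ℝ} (hB : 0 ≤ B) (hF : I.law (I.short S) ≠ 0)
    (hsmall : I.law {ω | B < walkLength I.root I.root (T.path ω)} ≤ I.law (I.short S) / 100)
    (m : ℕ) (hw : ∀ a, I.Reach S (m * B) a →
      ∫⁻ ω in I.short S, I.expWeight φ ((T.path ω).toFinset \ a) ∂I.law ≤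
        5 / 6 * I.law (I.short S)) :
    ∃ b, I.Reach S (m * B) b ∧
      ∫⁻ ω in I.short S ∩ {ω | walkLength I.root I.root (T.path ω) ≤ B},
        I.expWeight φ (b \ (S ∪ (T.path ω).toFinset)) ∂I.law ≤
      (17 / 20) ^ m * I.law (I.short S) := by
  induction m with
  | zero =>
    refine ⟨S, Inst.reach_self S (by simp), ?_⟩
    have : ∀ c : Finset V, S \ (S ∪ c) = ∅ := fun c =>
      Finset.sdiff_eq_empty_iff_subset.2 Finset.subset_union_left
    simp only [this, Inst.expWeight, prod_empty, setLIntegral_const, pow_zero]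
    exact mul_le_mul_right (measure_mono Set.inter_subset_left) _
  | succ m ih =>
    have e : ((m + 1 : ℕ) : ℝ) * B = m * B + B := by push_cast; ring
    rw [e] at hw ⊢
    obtain ⟨b, hb, hb'⟩ := ih fun a ha => hw a (ha.mono (by linarith))
    obtain ⟨b', h1, h2⟩ := I.exists_reach_step hφ T hr hB hb hF hsmall hw
    refine ⟨b', h1, h2.trans ?_⟩
    rw [pow_succ', mul_assoc]
    exact mul_le_mul_right hb' _

/-- One phase of the non-adaptive policy, with budget `80 * B`: unless all vertices can be visited
within this budget, the probability of falling short decreases by a constant factor, up to a multiple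
of the probability that the tour of the adaptive policy is longer than `B`. -/
theorem Inst.exists_phase {T : Policy V} (hT : I.Complete T) {S : Finset V} (hr : I.root ∈ S)
    {B : ℝ} (hB : 0 ≤ B) :
    ∃ p : List V, walkLength I.root I.root p ≤ 80 * B ∧ (S ∪ p.toFinset = univ ∨
      I.law (I.short (S ∪ p.toFinset)) ≤ 3 / 4 * I.law (I.short S) +
        100 * I.law {ω | B < walkLength I.root I.root (T.path ω)}) := by
  set G : Set (V → ℕ) := {ω | walkLength I.root I.root (T.path ω) ≤ B} with hG
  have hGc : {ω | B < walkLength I.root I.root (T.path ω)} = Gᶜ := by ext; simp [hG]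
  rw [hGc]
  set F := I.short S with hFdef
  rcases le_or_gt (I.law F) (100 * I.law Gᶜ) with hlarge | hlarge
  · refine ⟨[], by simpa [walkLength] using hB, Or.inr ?_⟩
    simp only [List.toFinset_nil, union_empty, ← hFdef]
    exact hlarge.trans le_add_self
  by_cases hall : ∃ ω ∈ G, I.visited (T.path ω) = univ
  · obtain ⟨ω, hω, h⟩ := hall
    refine ⟨T.path ω, le_trans hω (by linarith), Or.inl ?_⟩
    rw [← Finset.univ_subset_iff, ← h]
    refine Finset.insert_subset ?_ ?_
    · exact mem_union_left _ hr
    · exact subset_union_right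
  push Not at hall
  have hF : I.law F ≠ 0 := (bot_le.trans_lt hlarge).ne'
  have hsmall : I.law Gᶜ ≤ I.law F / 100 := by
    rw [ENNReal.le_div_iff_mul_le (by simp) (by simp), mul_comm]
    exact hlarge.le
  -- the largest threshold which the policy reaches with conditional probability one half outside
  -- every set that is visited by a short walk
  have hex : ∃ u : ℕ, ∃ a, I.Reach S (40 * B) a ∧
      I.law (F ∩ {ω | u ≤ ∑ v ∈ (T.path ω).toFinset \ a, ω v}) < I.law F / 2 := by
    have htend : Filter.Tendsto (fun u : ℕ => I.law
        (F ∩ {ω | u ≤ ∑ v ∈ (T.path ω).toFinset \ S, ω v})) Filter.atTop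
        (nhds (I.law (⋂ u : ℕ, F ∩ {ω | u ≤ ∑ v ∈ (T.path ω).toFinset \ S, ω v}))) := by
      refine tendsto_measure_iInter_atTop (fun _ => MeasurableSet.of_discrete.nullMeasurableSet) ?_
        ⟨0, measure_ne_top _ _⟩
      intro u u' huu' ω hω
      exact ⟨hω.1, le_trans huu' hω.2⟩
    have hempty : (⋂ u : ℕ, F ∩ {ω : V → ℕ | u ≤ ∑ v ∈ (T.path ω).toFinset \ S, ω v}) = ∅ := by
      ext ω
      simp only [Set.mem_iInter, Set.mem_inter_iff, Set.mem_ofPred_eq, Set.mem_empty_iff_false,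
        iff_false, not_forall]
      exact ⟨(∑ v ∈ (T.path ω).toFinset \ S, ω v) + 1, fun h => by have := h.2; omega⟩
    rw [hempty, measure_empty] at htend
    have hpos : 0 < I.law F / 2 := ENNReal.half_pos hF
    obtain ⟨u, hu⟩ := (htend.eventually_lt_const hpos).exists
    exact ⟨u, S, Inst.reach_self S (by linarith), hu⟩
  obtain ⟨u, hu, a, ha, hua⟩ : ∃ u : ℕ, (∀ a, I.Reach S (40 * B) a → I.law F / 2 ≤
      I.law (F ∩ {ω | u ≤ ∑ v ∈ (T.path ω).toFinset \ a, ω v})) ∧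
      ∃ a, I.Reach S (40 * B) a ∧
        I.law (F ∩ {ω | u < ∑ v ∈ (T.path ω).toFinset \ a, ω v}) < I.law F / 2 := by
    classical
    have hne : Nat.find hex ≠ 0 := by
      intro h0
      obtain ⟨a, -, ha⟩ := Nat.find_spec hex
      rw [h0] at ha
      simp only [zero_le, Set.ofPred_true, Set.inter_univ] at ha
      exact absurd ha (not_lt.2 ENNReal.half_le_self)
    obtain ⟨u, hu⟩ := Nat.exists_eq_succ_of_ne_zero hne
    refine ⟨u, fun a ha => ?_, ?_⟩
    · have := Nat.find_min hex (m := u) (by omega)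
      push Not at this
      exact this a ha
    · have := Nat.find_spec hex
      rw [hu] at this
      exact this
  -- a union of walks whose part outside the tour of the policy has reward at least `u`
  obtain ⟨b, hb, hYb⟩ : ∃ b, I.Reach S (40 * B) b ∧
      I.law (F ∩ {ω | ∑ v ∈ b \ (S ∪ (T.path ω).toFinset), ω v < u}) ≤ 1 / 20 * I.law F := by
    -- the weight `exp (-x / u)` needs `u ≠ 0`; for `u = 0` there is nothing to prove
    rcases eq_or_ne u 0 with rfl | hu0
    · exact ⟨S, Inst.reach_self S (by linarith), by simp⟩
    obtain ⟨φ, hφ1, hφu, hφl⟩ := exists_weight (V := V) hu0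
    obtain ⟨b, hb, hbw⟩ := I.exists_reach_iterate hφ1 T hr hB hF (by rwa [hGc]) 40
      (fun a ha => I.setLIntegral_expWeight_le hφ1 hφu T ha.subset (hu a (by simpa using ha)))
    refine ⟨b, by simpa using hb, ?_⟩
    set Y : Set (V → ℕ) := {ω | ∑ v ∈ b \ (S ∪ (T.path ω).toFinset), ω v < u} with hY
    have hfresh := I.lintegral_weight_unvisited φ b T (I.dependsOn_short S)
    rw [lintegral_indicator_mul, lintegral_indicator_mul] at hfresh
    have hsplit : ∫⁻ ω in F, I.expWeight φ (b \ (S ∪ (T.path ω).toFinset)) ∂I.law ≤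
        (17 / 20) ^ 40 * I.law F + I.law F / 100 := by
      calc _ ≤ ∫⁻ ω in (F ∩ G) ∪ Gᶜ, I.expWeight φ (b \ (S ∪ (T.path ω).toFinset)) ∂I.law := by
            refine lintegral_mono_set fun ω hω => ?_
            by_cases h : ω ∈ G
            · exact Or.inl ⟨hω, h⟩
            · exact Or.inr h
        _ ≤ _ := lintegral_union_le _ _ _
        _ ≤ (17 / 20) ^ 40 * I.law F + ∫⁻ _ in Gᶜ, 1 ∂I.law :=
            add_le_add hbw (lintegral_mono fun ω => I.expWeight_le_one hφ1 _)
        _ ≤ _ := by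
            rw [setLIntegral_const, one_mul]
            exact add_le_add le_rfl hsmall
    have hmarkov : I.law (F ∩ Y) * 3⁻¹ ≤
        ∫⁻ ω in F, ∏ v ∈ b \ (S ∪ (T.path ω).toFinset), φ (ω v) ∂I.law := by
      calc I.law (F ∩ Y) * 3⁻¹ = ∫⁻ _ in F ∩ Y, 3⁻¹ ∂I.law := by
            rw [setLIntegral_const, mul_comm]
        _ ≤ ∫⁻ ω in F ∩ Y, ∏ v ∈ b \ (S ∪ (T.path ω).toFinset), φ (ω v) ∂I.law :=
            setLIntegral_mono (measurable_of_countable _) fun ω hω => hφl _ _ hω.2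
        _ ≤ _ := lintegral_mono_set Set.inter_subset_left
    rw [hfresh] at hmarkov
    have h := hmarkov.trans hsplit
    have hf := measure_ne_top I.law F
    have hy := measure_ne_top I.law (F ∩ Y)
    generalize I.law (F ∩ Y) = y at *
    generalize I.law F = f at *
    lift f to ℝ≥0 using hf
    lift y to ℝ≥0 using hy
    have h' : y * 3⁻¹ ≤ (17 / 20) ^ 40 * f + f / 100 := by
      rw [← ENNReal.coe_le_coe]; push_cast; simpa using h
    have h'' : y ≤ 1 / 20 * f := by
      rw [← NNReal.coe_le_coe] at *
      push_cast at *
      have hn : ((17 : ℝ) / 20) ^ 40 ≤ 1 / 500 := by norm_num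
      have := mul_le_mul_of_nonneg_right hn f.2
      change _ * (f : ℝ) ≤ _ * (f : ℝ) at this
      have hf0 : 0 ≤ (f : ℝ) := f.2
      linarith
    have := ENNReal.coe_le_coe.2 h''
    push_cast at this
    simpa using this
  obtain ⟨p, hp, hpab⟩ := ha.union_reach hr hb
  refine ⟨p, by linarith, Or.inr ?_⟩
  rw [← hpab]
  -- outside four unlikely events, what the policy collects outside `a ∪ b` is made up for by `b`
  have hsub : I.short (a ∪ b) ⊆
      {ω | ¬ (I.k ≤ ∑ v ∈ I.visited (T.path ω), ω v ∨ I.visited (T.path ω) = univ)} ∪ (Gᶜ ∪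
      ((F ∩ {ω | u < ∑ v ∈ (T.path ω).toFinset \ a, ω v}) ∪
        (F ∩ {ω | ∑ v ∈ b \ (S ∪ (T.path ω).toFinset), ω v < u}))) := by
    intro ω hω
    have hSa : S ⊆ a ∪ b := ha.subset.trans subset_union_left
    have hωF : ω ∈ F := I.short_anti hSa hω
    by_contra hcon
    simp only [Set.mem_union, Set.mem_ofPred_eq, Set.mem_inter_iff, hωF, true_and, not_or, not_lt,
      Set.mem_compl_iff, not_not] at hcon
    obtain ⟨h1, h2, h3, h4⟩ := hcon
    have h5 : I.k ≤ ∑ v ∈ I.visited (T.path ω), ω v := by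
      by_contra h
      exact h1 ⟨h, hall ω h2⟩
    have h6 : ∑ v ∈ I.visited (T.path ω), ω v ≤ ∑ v ∈ a ∪ b, ω v := by
      rw [← Finset.sum_inter_add_sum_sdiff (I.visited (T.path ω)) (a ∪ b),
        ← Finset.sum_inter_add_sum_sdiff (a ∪ b) (I.visited (T.path ω)), Finset.inter_comm]
      refine Nat.add_le_add_left ?_ _
      calc _ ≤ ∑ v ∈ (T.path ω).toFinset \ a, ω v := by
            refine Finset.sum_le_sum_of_subset fun x hx => ?_
            simp only [Inst.visited, mem_sdiff, mem_insert, mem_union, not_or] at hx ⊢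
            refine ⟨hx.1.resolve_left ?_, hx.2.1⟩
            rintro rfl
            exact hx.2.1 (ha.subset hr)
        _ ≤ ∑ v ∈ b \ (S ∪ (T.path ω).toFinset), ω v := h3.trans h4
        _ ≤ _ := by
            refine Finset.sum_le_sum_of_subset fun x hx => ?_
            simp only [Inst.visited, mem_sdiff, mem_insert, mem_union, not_or] at hx ⊢
            refine ⟨Or.inr hx.1, ?_, hx.2.2⟩
            rintro rfl
            exact hx.2.1 hr
    exact absurd hω (not_lt.2 (h5.trans h6))
  have hnull : I.law
      {ω | ¬ (I.k ≤ ∑ v ∈ I.visited (T.path ω), ω v ∨ I.visited (T.path ω) = univ)} = 0 :=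
    ae_iff.1 hT
  calc _ ≤ 0 + (I.law F / 100 + (I.law F / 2 + 1 / 20 * I.law F)) := by
        refine (measure_mono hsub).trans ?_
        refine (measure_union_le _ _).trans (add_le_add hnull.le ?_)
        refine (measure_union_le _ _).trans (add_le_add hsmall ?_)
        exact (measure_union_le _ _).trans (add_le_add hua.le hYb)
    _ ≤ 3 / 4 * I.law F := by
        rw [zero_add, ENNReal.div_eq_inv_mul (a := I.law F), ENNReal.div_eq_inv_mul (a := I.law F),
          ← add_mul, ← add_mul]
        refine mul_le_mul_left ?_ _
        have : (100⁻¹ + (2⁻¹ + 1 / 20) : ℝ≥0) ≤ 3 / 4 := by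
          rw [← NNReal.coe_le_coe]; push_cast; norm_num
        have := ENNReal.coe_le_coe.2 this
        push_cast at this
        simpa using this
    _ ≤ _ := le_self_add

end Phase

/-! ### Following a list -/

section Lists

variable {V : Type*} [DecidableEq V]

theorem sum_insert_got {seen : Finset V} {got : ℕ} {ω : V → ℕ} (h : got = ∑ v ∈ seen, ω v)
    (v : V) : (if v ∈ seen then got else got + ω v) = ∑ v' ∈ insert v seen, ω v' := by
  split_ifs with hv
  · rw [Finset.insert_eq_self.2 hv, h]
  · rw [Finset.sum_insert hv, h, add_comm]

theorem followTour_complete (k : ℕ) (ω : V → ℕ) (l : List V) {seen : Finset V} {got : ℕ}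
    (h : got = ∑ v ∈ seen, ω v) :
    k ≤ ∑ v ∈ seen ∪ ((followTour k seen got l).path ω).toFinset, ω v ∨
      (followTour k seen got l).path ω = l := by
  induction l generalizing seen got with
  | nil => right; rfl
  | cons v l ih =>
    by_cases hk : k ≤ got
    · left
      simp [followTour, hk, Policy.path, ← h]
    · rw [followTour, if_neg hk]
      simp only [Policy.path]
      rcases ih (sum_insert_got h v) with h' | h'
      · left
        refine h'.trans_eq (Finset.sum_congr ?_ fun _ _ => rfl)
        ext x; simp
      · right; rw [h']

variable [PseudoMetricSpace V]

theorem walkLength_followTour_le (k : ℕ) (ω : V → ℕ) (r x : V) (l : List V) (seen : Finset V)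
    (got : ℕ) : walkLength r x ((followTour k seen got l).path ω) ≤ walkLength r x l := by
  induction l generalizing seen got x with
  | nil => rfl
  | cons v l ih =>
    by_cases hk : k ≤ got
    · simpa [followTour, hk, Policy.path, walkLength] using dist_le_walkLength r x (v :: l)
    · rw [followTour, if_neg hk]
      simpa [Policy.path, walkLength] using ih v _ _

theorem walkLength_followTour_of_le {k : ℕ} (ω : V → ℕ) (r : V) (l : List V) (seen : Finset V)
    {got : ℕ} (h : k ≤ got) : walkLength r r ((followTour k seen got l).path ω) = 0 := by
  cases l <;> simp [followTour, h, Policy.path, walkLength]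

/-- Following `l` and then `l'`, with a return to the root in between, costs at most the length of
`l` and, if `l` does not suffice, the cost of following `l'`. -/
theorem walkLength_followTour_append_le (k : ℕ) (ω : V → ℕ) {r : V} (x : V) (l l' : List V)
    {seen : Finset V} (hr : r ∈ seen) {got : ℕ} (h : got = ∑ v ∈ seen, ω v) :
    walkLength r x ((followTour k seen got (l ++ r :: l')).path ω) ≤ walkLength r x l +
      walkLength r r ((followTour k (seen ∪ l.toFinset)
        (∑ v ∈ seen ∪ l.toFinset, ω v) l').path ω) := by
  induction l generalizing seen got x with
  | nil =>
    by_cases hk : k ≤ got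
    · simpa [followTour, hk, Policy.path, walkLength] using walkLength_nonneg r r _
    · simp [followTour, hk, Policy.path, walkLength, hr, ← h]
  | cons v l ih =>
    by_cases hk : k ≤ got
    · have h1 := dist_le_walkLength r x (v :: l)
      have h2 := walkLength_nonneg r r ((followTour k (seen ∪ (v :: l).toFinset)
        (∑ v ∈ seen ∪ (v :: l).toFinset, ω v) l').path ω)
      simp only [List.cons_append, followTour, if_pos hk, Policy.path]
      simp only [walkLength] at *
      linarith
    · have := ih v (seen := insert v seen) (mem_insert_of_mem hr) (sum_insert_got h v)
      have e : insert v seen ∪ l.toFinset = seen ∪ (v :: l).toFinset := by ext; simp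
      rw [e] at this
      simp only [List.cons_append, followTour, if_neg hk, Policy.path, walkLength]
      linarith

end Lists

/-! ### Concatenation of the phases -/

section Main

variable {V : Type*} [Fintype V] [DecidableEq V] (I : Inst V)

theorem Inst.complete_nonAdaptive {l : List V} (hl : {I.root} ∪ l.toFinset = univ) :
    I.Complete (I.nonAdaptive l) := by
  refine Filter.Eventually.of_forall fun ω => ?_
  have := followTour_complete I.k ω l (seen := {I.root}) (got := ω I.root) (by simp)
  have hv : ∀ p : List V, I.visited (I.root :: p) = {I.root} ∪ p.toFinset := by
    intro p; simp [Inst.visited]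
  simp only [Inst.nonAdaptive, Policy.path, hv]
  rcases this with h | h
  · exact Or.inl h
  · right; rw [h, hl]

variable [PseudoMetricSpace V]

/-- The expected length of the tour that follows `l` after the vertices of `S` have been visited, on
the event that these fall short of the target. -/
noncomputable def Inst.remainingLength (S : Finset V) (l : List V) : ℝ≥0∞ :=
  ∫⁻ ω in I.short S, ENNReal.ofReal (walkLength I.root I.root
    ((followTour I.k S (∑ v ∈ S, ω v) l).path ω)) ∂I.law

theorem Inst.expectedLength_nonAdaptive (l : List V) :
    I.expectedLength (I.nonAdaptive l) = I.remainingLength {I.root} l := by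
  rw [Inst.expectedLength, Inst.remainingLength, ← lintegral_indicator MeasurableSet.of_discrete]
  congr 1 with ω
  simp only [Inst.nonAdaptive, Policy.path, walkLength, dist_self, zero_add, sum_singleton]
  by_cases h : ω ∈ I.short {I.root}
  · simp [h]
  · have h' : I.k ≤ ω I.root := by simpa [Inst.short] using h
    simp [h, walkLength_followTour_of_le ω I.root l {I.root} h']

theorem Inst.remainingLength_le (S : Finset V) {l : List V} {L : ℝ}
    (h : walkLength I.root I.root l ≤ L) :
    I.remainingLength S l ≤ ENNReal.ofReal L * I.law (I.short S) := by
  rw [← setLIntegral_const]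
  exact lintegral_mono fun ω => ENNReal.ofReal_le_ofReal
    ((walkLength_followTour_le _ _ _ _ _ _ _).trans h)

theorem Inst.remainingLength_append_le {S : Finset V} (hr : I.root ∈ S) {l : List V} (l' : List V)
    {L : ℝ} (h : walkLength I.root I.root l ≤ L) :
    I.remainingLength S (l ++ I.root :: l') ≤
      ENNReal.ofReal L * I.law (I.short S) + I.remainingLength (S ∪ l.toFinset) l' := by
  have hsub : I.short (S ∪ l.toFinset) ⊆ I.short S := I.short_anti Finset.subset_union_left
  set g : (V → ℕ) → ℝ≥0∞ := fun ω => ENNReal.ofReal (walkLength I.root I.root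
    ((followTour I.k (S ∪ l.toFinset) (∑ v ∈ S ∪ l.toFinset, ω v) l').path ω)) with hg
  calc _ ≤ ∫⁻ ω in I.short S, ENNReal.ofReal L +
        (I.short (S ∪ l.toFinset)).indicator g ω ∂I.law := by
        refine lintegral_mono fun ω => ?_
        refine (ENNReal.ofReal_le_ofReal
          (walkLength_followTour_append_le I.k ω I.root l l' hr rfl)).trans ?_
        refine ENNReal.ofReal_add_le.trans (add_le_add (ENNReal.ofReal_le_ofReal h) ?_)
        by_cases hω : ω ∈ I.short (S ∪ l.toFinset)
        · simp [hω, hg]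
        · have : I.k ≤ ∑ v ∈ S ∪ l.toFinset, ω v := by simpa [Inst.short] using hω
          rw [walkLength_followTour_of_le _ _ _ _ this]
          simp
    _ = _ := by
        rw [lintegral_add_left (measurable_of_countable _), setLIntegral_const,
          setLIntegral_indicator MeasurableSet.of_discrete, Set.inter_eq_left.2 hsub]
        rfl

/-- The phases `i, i + 1, …, n`, with budgets that grow by the factor `5 / 4`, and a last phase that
visits everything. The constants are such that `80 + 1280 * (5 / 4) * (3 / 4) = 1280`, and
`1280 * (5 / 4) * 100 = 160000`. -/
theorem Inst.exists_phases {T : Policy V} (hT : I.Complete T) (b : ℝ≥0) (n : ℕ)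
    (hn : walkLength I.root I.root (univ : Finset V).toList ≤ 80 * (b * (5 / 4) ^ n))
    (j i : ℕ) (hij : i + j = n) (S : Finset V) (hr : I.root ∈ S) :
    ∃ l : List V, S ∪ l.toFinset = univ ∧
      I.remainingLength S l ≤ 1280 * ((b * (5 / 4) ^ i : ℝ≥0) : ℝ≥0∞) * I.law (I.short S) +
        160000 * ∑ t ∈ Ico i n, ((b * (5 / 4) ^ t : ℝ≥0) : ℝ≥0∞) *
          I.law {ω | ((b * (5 / 4) ^ t : ℝ≥0) : ℝ) < walkLength I.root I.root (T.path ω)} := by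
  have hreal : ∀ c : ℝ≥0, ENNReal.ofReal (80 * (c : ℝ)) = 80 * (c : ℝ≥0∞) := by
    intro c
    rw [ENNReal.ofReal_mul (by norm_num)]
    simp
  induction j generalizing i S with
  | zero =>
    obtain rfl : i = n := by omega
    refine ⟨(univ : Finset V).toList, by simp, ?_⟩
    refine (I.remainingLength_le S (L := 80 * ((b * (5 / 4) ^ i : ℝ≥0) : ℝ))
      (by push_cast; exact hn)).trans (le_add_right ?_)
    rw [hreal]
    gcongr
    norm_num
  | succ j ih =>
    set B : ℝ≥0 := b * (5 / 4) ^ i with hB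
    have hB' : b * (5 / 4) ^ (i + 1) = B * (5 / 4) := by rw [hB, pow_succ, mul_assoc]
    obtain ⟨p, hp, hcase⟩ := I.exists_phase hT hr (B := (B : ℝ)) B.2
    rcases hcase with huniv | hshort
    · refine ⟨p, huniv, (I.remainingLength_le S hp).trans (le_add_right ?_)⟩
      rw [hreal]
      gcongr
      norm_num
    · obtain ⟨l, hl, hle⟩ := ih (i + 1) (by omega) (S ∪ p.toFinset) (mem_union_left _ hr)
      refine ⟨p ++ I.root :: l, ?_, ?_⟩
      · rw [← Finset.univ_subset_iff, ← hl]
        intro x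
        simp only [mem_union, List.mem_toFinset, List.mem_append, List.mem_cons]
        tauto
      · refine (I.remainingLength_append_le hr l hp).trans ?_
        rw [hreal, Finset.sum_eq_sum_Ico_succ_bot (by omega), ← hB]
        refine (add_le_add_right hle _).trans ?_
        rw [hB']
        set q := I.law {ω | (B : ℝ) < walkLength I.root I.root (T.path ω)}
        set R := ∑ t ∈ Ico (i + 1) n, ((b * (5 / 4) ^ t : ℝ≥0) : ℝ≥0∞) *
          I.law {ω | ((b * (5 / 4) ^ t : ℝ≥0) : ℝ) < walkLength I.root I.root (T.path ω)}
        set f := I.law (I.short S)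
        have hc : (1280 * (5 / 4) * (3 / 4) : ℝ≥0∞) = 1200 ∧
            (1280 * (5 / 4) * 100 : ℝ≥0∞) = 160000 := by
          have h1 : (1280 * (5 / 4) * (3 / 4) : ℝ≥0) = 1200 := by
            rw [← NNReal.coe_inj]; push_cast; norm_num
          have h2 : (1280 * (5 / 4) * 100 : ℝ≥0) = 160000 := by
            rw [← NNReal.coe_inj]; push_cast; norm_num
          have h1' := congrArg (fun x : ℝ≥0 => (x : ℝ≥0∞)) h1
          have h2' := congrArg (fun x : ℝ≥0 => (x : ℝ≥0∞)) h2
          push_cast at h1' h2'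
          exact ⟨by simpa using h1', by simpa using h2'⟩
        have h54 : ((5 / 4 : ℝ≥0) : ℝ≥0∞) = 5 / 4 := by simp
        rw [ENNReal.coe_mul B, h54]
        calc _ ≤ 80 * (B : ℝ≥0∞) * f + (1280 * ((B : ℝ≥0∞) * (5 / 4)) * (3 / 4 * f + 100 * q) +
              160000 * R) := by gcongr
          _ = 80 * B * f + (1280 * (5 / 4) * (3 / 4)) * B * f + (1280 * (5 / 4) * 100) * (B * q) +
              160000 * R := by ring
          _ = (80 + 1200) * B * f + 160000 * (B * q + R) := by rw [hc.1, hc.2]; ring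
          _ = _ := by norm_num

omit [DecidableEq V] in
/-- Summing the tail probabilities of the tour length at the points of a geometric grid gives at most
a constant times the expected length. -/
theorem Inst.sum_tail_le (T : Policy V) (b : ℝ≥0) (n : ℕ) :
    ∑ t ∈ Ico 0 n, ((b * (5 / 4) ^ t : ℝ≥0) : ℝ≥0∞) *
      I.law {ω | ((b * (5 / 4) ^ t : ℝ≥0) : ℝ) < walkLength I.root I.root (T.path ω)} ≤
    5 * I.expectedLength T := by
  -- the geometric sum is at most `4` times the first omitted term and `5` times the last term
  have hpt : ∀ d : ℝ, 0 ≤ d → ∀ n : ℕ,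
      ∑ t ∈ range n, (if ((b * (5 / 4) ^ t : ℝ≥0) : ℝ) < d then (b * (5 / 4) ^ t : ℝ≥0) else 0 : ℝ) ≤
        4 * (b * (5 / 4) ^ n : ℝ≥0) ∧
      ∑ t ∈ range n, (if ((b * (5 / 4) ^ t : ℝ≥0) : ℝ) < d then (b * (5 / 4) ^ t : ℝ≥0) else 0 : ℝ) ≤
        5 * d := by
    intro d hd n
    induction n with
    | zero => simp [hd]
    | succ n ih =>
      rw [sum_range_succ]
      have e : ((b * (5 / 4) ^ (n + 1) : ℝ≥0) : ℝ) = (b * (5 / 4) ^ n : ℝ≥0) * (5 / 4) := by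
        push_cast; ring
      have h0 : (0 : ℝ) ≤ (b * (5 / 4) ^ n : ℝ≥0) := NNReal.coe_nonneg _
      rw [e]
      split_ifs with h
      · constructor <;> linarith
      · constructor <;> linarith
  rw [Inst.expectedLength, ← lintegral_const_mul _ (measurable_of_countable _)]
  calc _ = ∫⁻ ω, ∑ t ∈ Ico 0 n, (if ((b * (5 / 4) ^ t : ℝ≥0) : ℝ) <
          walkLength I.root I.root (T.path ω) then ((b * (5 / 4) ^ t : ℝ≥0) : ℝ≥0∞) else 0)
          ∂I.law := by
        rw [lintegral_finsetSum _ fun _ _ => measurable_of_countable _]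
        refine Finset.sum_congr rfl fun t _ => ?_
        rw [← setLIntegral_const, ← lintegral_indicator MeasurableSet.of_discrete]
        rfl
    _ ≤ _ := by
        refine lintegral_mono fun ω => ?_
        have := (hpt _ (walkLength_nonneg I.root I.root (T.path ω)) n).2
        have h2 := ENNReal.ofReal_le_ofReal this
        rw [ENNReal.ofReal_mul (by norm_num), ENNReal.ofReal_sum_of_nonneg] at h2
        · rw [← Finset.range_eq_Ico]
          refine le_trans (le_of_eq (Finset.sum_congr rfl fun t _ => ?_))
            (h2.trans (le_of_eq (by simp)))
          split_ifs
          · rw [ENNReal.ofReal_coe_nnreal]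
          · simp
        · intro t _
          split_ifs
          · exact NNReal.coe_nonneg _
          · exact le_rfl

theorem Inst.exists_nonAdaptive_le {T : Policy V} (hT : I.Complete T) {b : ℝ≥0} (hb : b ≠ 0) :
    ∃ l : List V, I.Complete (I.nonAdaptive l) ∧
      I.expectedLength (I.nonAdaptive l) ≤ 1280 * b + 800000 * I.expectedLength T := by
  obtain ⟨n, hn⟩ : ∃ n : ℕ,
      walkLength I.root I.root (univ : Finset V).toList ≤ 80 * (b * (5 / 4) ^ n) := by
    have hb' : (0 : ℝ) < b := by positivity
    obtain ⟨n, hn⟩ := pow_unbounded_of_one_lt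
      (walkLength I.root I.root (univ : Finset V).toList / (80 * b)) (by norm_num : (1 : ℝ) < 5 / 4)
    refine ⟨n, ?_⟩
    rw [div_lt_iff₀ (by positivity)] at hn
    linarith
  obtain ⟨l, hl, hle⟩ := I.exists_phases hT b n hn n 0 (by simp) {I.root} (by simp)
  refine ⟨l, I.complete_nonAdaptive hl, ?_⟩
  rw [I.expectedLength_nonAdaptive]
  refine hle.trans (add_le_add ?_ ?_)
  · rw [pow_zero, mul_one]
    exact mul_le_of_le_one_right' prob_le_one
  · refine (mul_le_mul_right (I.sum_tail_le T b n) _).trans (le_of_eq ?_)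
    rw [← mul_assoc]
    norm_num

/-- If the optimum is zero, it suffices to visit the vertices at distance zero from the root. -/
theorem Inst.exists_nonAdaptive_of_opt_eq_zero (h : I.opt = 0) :
    ∃ l : List V, I.Complete (I.nonAdaptive l) ∧ I.expectedLength (I.nonAdaptive l) = 0 := by
  classical
  set Z : Finset V := univ.filter fun v => dist v I.root = 0 with hZ
  have hrZ : I.root ∈ Z := by simp [hZ]
  have hroot : ∀ p : List V, I.visited (I.root :: p) = {I.root} ∪ p.toFinset := by
    intro p; simp [Inst.visited]
  have hlen : I.expectedLength (I.nonAdaptive Z.toList) = 0 := by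
    rw [I.expectedLength_nonAdaptive, ← nonpos_iff_eq_zero]
    refine (I.remainingLength_le {I.root} (L := 0) (le_of_eq ?_)).trans (by simp)
    exact walkLength_eq_zero (fun v hv => by simpa [hZ] using hv) (dist_self _)
  refine ⟨Z.toList, ?_, hlen⟩
  obtain ⟨δ, hδ, hδ'⟩ : ∃ δ : ℝ, 0 < δ ∧ ∀ v ∉ Z, δ ≤ dist v I.root := by
    rcases (univ \ Z).eq_empty_or_nonempty with he | hne
    · refine ⟨1, one_pos, fun v hv => ?_⟩
      have : v ∈ univ \ Z := by simp [hv]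
      simp [he] at this
    · obtain ⟨w, hw, hmin⟩ := Finset.exists_min_image _ (fun v => dist v I.root) hne
      refine ⟨dist w I.root, ?_, fun v hv => hmin v (by simp [hv])⟩
      refine lt_of_le_of_ne dist_nonneg fun h0 => ?_
      simp [hZ, ← h0] at hw
  -- on `E` every complete policy has to leave `Z`, at cost at least `δ`
  set E : Set (V → ℕ) := {ω | ¬ (I.k ≤ ∑ v ∈ Z, ω v ∨ Z = univ)} with hE
  have hbound : ENNReal.ofReal δ * I.law E ≤ I.opt := by
    refine le_iInf₂ fun T hT => ?_
    rw [← setLIntegral_const, Inst.expectedLength]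
    calc _ = ∫⁻ ω, E.indicator (fun _ => ENNReal.ofReal δ) ω ∂I.law := by
          rw [lintegral_indicator MeasurableSet.of_discrete]
      _ ≤ _ := by
          refine lintegral_mono_ae ?_
          filter_upwards [hT] with ω hω
          by_cases hωE : ω ∈ E
          · rw [Set.indicator_of_mem hωE]
            refine ENNReal.ofReal_le_ofReal ?_
            obtain ⟨v, hv, hvZ⟩ : ∃ v ∈ T.path ω, v ∉ Z := by
              by_contra! hcon
              have hsub : I.visited (T.path ω) ⊆ Z :=
                Finset.insert_subset hrZ fun v hv => hcon v (by simpa using hv)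
              refine hωE ?_
              rcases hω with h1 | h1
              · exact Or.inl (h1.trans (Finset.sum_le_sum_of_subset hsub))
              · exact Or.inr (Finset.univ_subset_iff.1 (h1 ▸ hsub))
            exact (hδ' v hvZ).trans (dist_le_walkLength_of_mem hv)
          · simp [hωE]
  have hE0 : I.law E = 0 := by
    rw [h, nonpos_iff_eq_zero, mul_eq_zero] at hbound
    exact hbound.resolve_left (by simpa using hδ)
  refine (ae_iff.2 hE0 : ∀ᵐ ω ∂I.law, I.k ≤ ∑ v ∈ Z, ω v ∨ Z = univ).mono fun ω hω => ?_
  have := followTour_complete I.k ω Z.toList (seen := {I.root}) (got := ω I.root) (by simp)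
  simp only [Inst.nonAdaptive, Policy.path, hroot]
  rcases this with h1 | h1
  · exact Or.inl h1
  · rw [h1, Finset.toList_toFinset, Finset.union_eq_right.2 (by simpa using hrZ)]
    exact hω

end Main

end StochKTSP

theorem theorem1 :
    ∃ C : ℝ≥0, ∀ (V : Type*) [Fintype V] [DecidableEq V] [PseudoMetricSpace V]
      (I : StochKTSP.Inst V),
      ∃ l : List V, I.Complete (I.nonAdaptive l) ∧
        I.expectedLength (I.nonAdaptive l) ≤ C * I.opt := by
  refine ⟨1601280, fun V _ _ _ I => ?_⟩
  rcases eq_or_ne I.opt 0 with h0 | h0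
  · obtain ⟨l, hl, hl'⟩ := I.exists_nonAdaptive_of_opt_eq_zero h0
    exact ⟨l, hl, by simp [hl']⟩
  rcases eq_or_ne I.opt ∞ with htop | htop
  · exact ⟨Finset.univ.toList, I.complete_nonAdaptive (by simp), by simp [htop]⟩
  obtain ⟨T, hT, hlt⟩ : ∃ T, ∃ _ : I.Complete T, I.expectedLength T < 2 * I.opt := by
    have : I.opt < 2 * I.opt := by
      rw [two_mul]; exact ENNReal.lt_add_right htop h0
    simpa only [StochKTSP.Inst.opt, iInf_lt_iff] using this
  obtain ⟨l, hl, hle⟩ := I.exists_nonAdaptive_le hT (b := I.opt.toNNReal)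
    (by simp [ENNReal.toNNReal_eq_zero_iff, h0, htop])
  refine ⟨l, hl, hle.trans ?_⟩
  rw [ENNReal.coe_toNNReal htop]
  calc _ ≤ 1280 * I.opt + 800000 * (2 * I.opt) := by gcongr
    _ = (1280 + 800000 * 2) * I.opt := by ring
    _ = _ := by norm_num
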